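/- Let $\mathbf{k}$ be a field and let $q \in \mathbf{k}$ be nonzero. For $n \ge 0$ let $\mathcal{H}_n$ be the Hecke algebra of the symmetric group $S_n$, that is, the unital associative $\mathbf{k}$-algebra with generators $T_1, \dots, T_{n-1}$ and relations $T_i^2 = (q-1)T_i + q$; $T_iT_j = T_jT_i$ for $|i-j|>1$; and $T_iT_{i+1}T_i = T_{i+1}T_iT_{i+1}$. For $w \in S_n$ put $T_w = T_{i_1}\cdots T_{i_m}$, where $s_{i_1}\cdots s_{i_m}$ is any reduced expression of $w$ in the simple transpositions $s_i = (i,i+1)$. Elements of $\mathcal{H}_m$ with $m \le n$ are regarded as elements of $\mathcal{H}_n$ via $T_i \mapsto T_i$. Let $a \mapsto a^*$ be the algebra anti-automorphism of $\mathcal{H}_n$ that fixes every $T_i$ (so $T_w^* = T_{w^{-1}}$). Write $[m]_q = 1 + q + \cdots + q^{m-1}$ and $[m]!_q = [1]_q[2]_q\cdots[m]_q$. Define $$\mathcal{B}_n = \sum_{i=1}^n T_{n-1}T_{n-2}\cdots T_i, \qquad \mathcal{B}_{n,k} = \mathcal{B}_{n-(k-1)}\cdots\mathcal{B}_{n-1}\mathcal{B}_n,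 \qquad \mathcal{R}_{n,k} = \frac{1}{[k]!_q}\,\mathcal{B}_{n,k}^*\,\mathcal{B}_{n,k},$$ where $\mathcal{B}_m = 0$ for $m \le 0$ (so $\mathcal{B}_{n,0} = \mathcal{R}_{n,0} = 1$, and $\mathcal{B}_{n,k} = \mathcal{R}_{n,k} = 0$ for $k > n$). For every value of $q$ (even when $[k]!_q = 0$), $\mathcal{R}_{n,k}$ is understood by computing it for an indeterminate parameter, where the product $\mathcal{B}_{n,k}^*\mathcal{B}_{n,k}$ is divisible by the $q$-factorial over the integer polynomials in the parameter, and then substituting $q$ for the indeterminate. Finally, let $$J_n = \sum_{i=1}^{n-1} q^{i-n}\, T_{(i,n)}$$ be the $n$-th Young--Jucys--Murphy element, where $(i,n)$ is the transposition swapping $i$ and $n$. Then, for all integers $1 \le k \le n$, the following identity holds in $\mathcal{H}_n$: $$\mathcal{B}_n\,\mathcal{R}_{n,k} = \Big(q^k\,\mathcal{R}_{n-1,k} + \big([n+1-k]_q + q^{n+1-k}J_n\big)\,\mathcal{R}_{n-1,k-1}\Big)\,\mathcal{B}_n .$$ -/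

import Mathlib

namespace HeckeShuffle

/-- Indices `1, 2, …, n - 1` of the generators of the Hecke algebra of the symmetric group on
`n` letters. -/
abbrev Gen (n : ℕ) : Type := {i : ℕ // i ∈ Finset.Ico 1 n}

/-- The defining relations of the Hecke algebra `H_n(q)`. -/
inductive Rel {R : Type*} [CommRing R] (q : R) (n : ℕ) :
    FreeAlgebra R (Gen n) → FreeAlgebra R (Gen n) → Prop
  | quadratic (i : Gen n) :
      Rel q n (FreeAlgebra.ι R i ^ 2) ((q - 1) • FreeAlgebra.ι R i + algebraMap R _ q)
  | comm (i j : Gen n) (h : i.1 + 1 < j.1 ∨ j.1 + 1 < i.1) :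
      Rel q n (FreeAlgebra.ι R i * FreeAlgebra.ι R j) (FreeAlgebra.ι R j * FreeAlgebra.ι R i)
  | braid (i j : Gen n) (h : j.1 = i.1 + 1) :
      Rel q n (FreeAlgebra.ι R i * FreeAlgebra.ι R j * FreeAlgebra.ι R i)
        (FreeAlgebra.ι R j * FreeAlgebra.ι R i * FreeAlgebra.ι R j)

/-- The Hecke algebra `H_n(q)`: the unital associative `R`-algebra generated by
`T_1, …, T_{n-1}` subject to the quadratic, commutation and braid relations. -/
abbrev Hecke {R : Type*} [CommRing R] (q : R) (n : ℕ) : Type _ := RingQuot (Rel q n)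

/-- The generator `T_i`, for an index `i` in `{1, …, n - 1}`. -/
noncomputable def gen {R : Type*} [CommRing R] (q : R) (n : ℕ) (i : Gen n) : Hecke q n :=
  RingQuot.mkAlgHom R (Rel q n) (FreeAlgebra.ι R i)

theorem gen_sq {R : Type*} [CommRing R] (q : R) (n : ℕ) (i : Gen n) :
    gen q n i ^ 2 = (q - 1) • gen q n i + algebraMap R _ q := by
  have h := RingQuot.mkAlgHom_rel R (Rel.quadratic (q := q) i)
  simpa only [gen, map_pow, map_add, map_smul, AlgHom.commutes] using h

theorem gen_comm {R : Type*} [CommRing R] (q : R) (n : ℕ) (i j : Gen n)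
    (h : i.1 + 1 < j.1 ∨ j.1 + 1 < i.1) :
    gen q n i * gen q n j = gen q n j * gen q n i := by
  have h := RingQuot.mkAlgHom_rel R (Rel.comm (q := q) i j h)
  simpa only [gen, map_mul] using h

theorem gen_braid {R : Type*} [CommRing R] (q : R) (n : ℕ) (i j : Gen n) (h : j.1 = i.1 + 1) :
    gen q n i * gen q n j * gen q n i = gen q n j * gen q n i * gen q n j := by
  have h := RingQuot.mkAlgHom_rel R (Rel.braid (q := q) i j h)
  simpa only [gen, map_mul] using h

/-- The generator `T_i` indexed by a natural number (only used for `1 ≤ i ≤ n - 1`;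
`0` for other `i`). -/
noncomputable def T {R : Type*} [CommRing R] (q : R) (n i : ℕ) : Hecke q n :=
  if h : i ∈ Finset.Ico 1 n then gen q n ⟨i, h⟩ else 0

/-- The canonical homomorphism `H_m(q) → H_n(q)`, `T_i ↦ T_i`, for `m ≤ n`. -/
noncomputable def incl {R : Type*} [CommRing R] (q : R) {m n : ℕ} (h : m ≤ n) :
    Hecke q m →ₐ[R] Hecke q n :=
  RingQuot.liftAlgHom R
    ⟨FreeAlgebra.lift R fun i : Gen m =>
      gen q n ⟨i.1, Finset.Ico_subset_Ico_right h i.2⟩, by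
      intro x y hxy
      cases hxy with
      | quadratic i =>
        simpa only [map_pow, map_add, map_smul, AlgHom.commutes, FreeAlgebra.lift_ι_apply]
          using gen_sq q n _
      | comm i j hij =>
        simpa only [map_mul, FreeAlgebra.lift_ι_apply] using gen_comm q n _ _ hij
      | braid i j hij =>
        simpa only [map_mul, FreeAlgebra.lift_ι_apply] using gen_braid q n _ _ hij⟩

/-- The change of scalars `H_n(q) → H_n(q')` along a ring homomorphism `f : R → S` with
`f q = q'`; it is `f` on scalars and sends each `T_i` to `T_i`. -/
noncomputable def changeScalars {R S : Type*} [CommRing R] [CommRing S] (f : R →+* S) {q : R}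
    {q' : S} (hf : f q = q') (n : ℕ) : Hecke q n →+* Hecke q' n :=
  letI : Algebra R (Hecke q' n) := Algebra.compHom (Hecke q' n) f
  have hmap : ∀ r : R, algebraMap R (Hecke q' n) r = algebraMap S (Hecke q' n) (f r) :=
    fun _ => rfl
  (RingQuot.liftAlgHom R
    ⟨FreeAlgebra.lift R (gen q' n), by
      intro x y hxy
      cases hxy with
      | quadratic i =>
        simp only [Algebra.smul_def, map_mul, map_pow, map_add, AlgHom.commutes,
          FreeAlgebra.lift_ι_apply, hmap]
        rw [gen_sq, Algebra.smul_def, map_sub f, map_one f, hf]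
      | comm i j hij =>
        simpa only [map_mul, FreeAlgebra.lift_ι_apply] using gen_comm q' n _ _ hij
      | braid i j hij =>
        simpa only [map_mul, FreeAlgebra.lift_ι_apply] using gen_braid q' n _ _ hij⟩ :
    Hecke q n →ₐ[R] Hecke q' n).toRingHom

/-- The algebra anti-automorphism of `H_n(q)` fixing every generator, as a homomorphism to the
opposite algebra. -/
noncomputable def antiHom {R : Type*} [CommRing R] (q : R) (n : ℕ) :
    Hecke q n →ₐ[R] (Hecke q n)ᵐᵒᵖ :=
  RingQuot.liftAlgHom R
    ⟨FreeAlgebra.lift R fun i : Gen n => MulOpposite.op (gen q n i), by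
      intro x y hxy
      cases hxy with
      | quadratic i =>
        simp only [map_pow, map_add, map_smul, AlgHom.commutes, FreeAlgebra.lift_ι_apply]
        rw [← MulOpposite.op_pow, gen_sq]
        rfl
      | comm i j hij =>
        simp only [map_mul, FreeAlgebra.lift_ι_apply, ← MulOpposite.op_mul]
        rw [gen_comm q n i j hij]
      | braid i j hij =>
        simp only [map_mul, FreeAlgebra.lift_ι_apply, ← MulOpposite.op_mul, ← mul_assoc]
        rw [gen_braid q n i j hij]⟩

/-- `a ↦ a^*`: the anti-automorphism of `H_n(q)` that fixes every `T_i` (equivalently, sends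
`T_w` to `T_{w⁻¹}`). -/
noncomputable def heckeStar {R : Type*} [CommRing R] {q : R} {n : ℕ} (a : Hecke q n) :
    Hecke q n :=
  (antiHom q n a).unop

/-- The letter `i ∈ {1, …, n}` as an element of `Fin n = {0, …, n - 1}`, for `i < n`. -/
def letter {n : ℕ} (i : Gen n) : Fin n :=
  ⟨i.1 - 1, by have := Finset.mem_Ico.1 i.2; omega⟩

/-- The letter `i + 1` as an element of `Fin n`, for `i < n`. -/
def nextLetter {n : ℕ} (i : Gen n) : Fin n :=
  ⟨i.1, (Finset.mem_Ico.1 i.2).2⟩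

/-- The letter `n` as an element of `Fin n`, given that `{1, …, n - 1}` is non-empty. -/
def lastLetter {n : ℕ} (i : Gen n) : Fin n :=
  ⟨n - 1, by have := Finset.mem_Ico.1 i.2; omega⟩

/-- The simple transposition `s_i = (i, i + 1)`. -/
def simpleSwap {n : ℕ} (i : Gen n) : Equiv.Perm (Fin n) :=
  Equiv.swap (letter i) (nextLetter i)

/-- `l` is (the list of indices of) a reduced expression for `w`: a way of writing `w` as a
product of simple transpositions with the minimum number of factors. -/
def IsReducedExpr {n : ℕ} (w : Equiv.Perm (Fin n)) (l : List (Gen n)) : Prop :=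
  (l.map simpleSwap).prod = w ∧
    ∀ l' : List (Gen n), (l'.map simpleSwap).prod = w → l.length ≤ l'.length

theorem exists_isReducedExpr {n : ℕ} (w : Equiv.Perm (Fin n)) : ∃ l, IsReducedExpr w l := by
  have hex : ∃ l : List (Gen n), (l.map simpleSwap).prod = w := by
    cases n with
    | zero => exact ⟨[], Subsingleton.elim _ _⟩
    | succ m =>
      have hw : w ∈ Submonoid.closure
          (Set.range fun i : Fin m => Equiv.swap i.castSucc i.succ) := by
        rw [Equiv.Perm.mclosure_swap_castSucc_succ]; trivial
      induction hw using Submonoid.closure_induction with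
      | mem x hx =>
        obtain ⟨i, rfl⟩ := hx
        refine ⟨[⟨i.1 + 1, Finset.mem_Ico.2 ⟨by omega, by omega⟩⟩], ?_⟩
        simp only [List.map_cons, List.map_nil, List.prod_cons, List.prod_nil, mul_one]
        rfl
      | one => exact ⟨[], rfl⟩
      | mul x y _ _ hx hy =>
        obtain ⟨l, rfl⟩ := hx
        obtain ⟨l', rfl⟩ := hy
        exact ⟨l ++ l', by simp⟩
  classical
  have hlen : ∃ N : ℕ, ∃ l : List (Gen n), l.length = N ∧ (l.map simpleSwap).prod = w :=
    hex.elim fun l hl => ⟨l.length, l, rfl, hl⟩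
  obtain ⟨l, hl, hlw⟩ := Nat.find_spec hlen
  exact ⟨l, hlw, fun l' hl' => hl ▸ Nat.find_min' hlen ⟨l', rfl, hl'⟩⟩

/-- The standard basis element `T_w = T_{i_1} ⋯ T_{i_k}`, where `s_{i_1} ⋯ s_{i_k}` is a reduced
expression for `w` (the product does not depend on which one). -/
noncomputable def Tw {R : Type*} [CommRing R] (q : R) {n : ℕ} (w : Equiv.Perm (Fin n)) :
    Hecke q n :=
  ((exists_isReducedExpr w).choose.map (gen q n)).prod

/-- The `q`-integer `[k]_q = 1 + q + ⋯ + q^{k-1}`. -/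
def qInt {R : Type*} [CommRing R] (q : R) (k : ℕ) : R := ∑ i ∈ Finset.range k, q ^ i

/-- The `q`-factorial `[k]!_q = [1]_q [2]_q ⋯ [k]_q`. -/
def qFactorial {R : Type*} [CommRing R] (q : R) (k : ℕ) : R :=
  ∏ i ∈ Finset.Icc 1 k, qInt q i

/-- The bottom-to-random element `B_n = ∑_{i=1}^n T_{n-1} T_{n-2} ⋯ T_i`
(note that `List.range' i (n - i) = [i, i + 1, …, n - 1]`). -/
noncomputable def B {R : Type*} [CommRing R] (q : R) (n : ℕ) : Hecke q n :=
  ∑ i ∈ Finset.Icc 1 n, ((List.range' i (n - i)).reverse.map (T q n)).prod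

/-- The `k`-bottom-to-random element `B_{n,k} = B_{n-(k-1)} ⋯ B_{n-1} B_n` of `H_n(q)`. For
`k > n`, the factor `B_0 = 0` occurs, so that `B_{n,k} = 0`. -/
noncomputable def Bk {R : Type*} [CommRing R] (q : R) (n k : ℕ) : Hecke q n :=
  ((List.range k).reverse.map fun j => incl q (Nat.sub_le n j) (B q (n - j))).prod

open Classical in
/-- `R_{n,k}` for an indeterminate parameter `X`: the element `r` of the Hecke algebra over
`ℤ[X]` with `[k]!_X r = B_{n,k}^* B_{n,k}`. -/
noncomputable def genericR (n k : ℕ) : Hecke (Polynomial.X : Polynomial ℤ) n :=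
  if h : ∃ r : Hecke (Polynomial.X : Polynomial ℤ) n,
      qFactorial (Polynomial.X : Polynomial ℤ) k • r =
        heckeStar (Bk Polynomial.X n k) * Bk Polynomial.X n k
  then h.choose else 0

/-- The `k`-random-to-random element `R_{n,k} = (1 / [k]!_q) B_{n,k}^* B_{n,k}` of `H_n(q)`,
for an arbitrary value of `q`: it is computed for an indeterminate parameter, and then `q` is
substituted for the indeterminate. -/
noncomputable def R {𝕜 : Type*} [Field 𝕜] (q : 𝕜) (n k : ℕ) : Hecke q n :=
  changeScalars (Polynomial.eval₂RingHom (Int.castRingHom 𝕜) q) (by simp) n (genericR n k)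

/-- The `n`-th Young–Jucys–Murphy element `J_n = ∑_{i=1}^{n-1} q^{i-n} T_{(i,n)}` (for
`q ≠ 0`). -/
noncomputable def J {𝕜 : Type*} [Field 𝕜] (q : 𝕜) (n : ℕ) : Hecke q n :=
  ∑ i : Gen n, q ^ ((i.1 : ℤ) - (n : ℤ)) • Tw q (Equiv.swap (letter i) (lastLetter i))

end HeckeShuffle

/-! Write S_{n,k} for B_{n,k}^* B_{n,k} (`shuffleSq`). The identity multiplied by q^k [k]!_q
involves no division, and it holds for any sequence satisfying the Hecke relations
(`pow_smul_descSum_mul_shuffleSq`). It rests on two facts: B_n B_n^* = B_{n-1}^* T_{n-1} B_{n-1} +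
[n]_q + q^n J_n (`descSum_mul_ascSum`), and T_{n-1} B_{n-1} B_n = q B_{n-1} B_n
(`mul_descSum_mul_descSum`). Induct on k with n - k fixed. In B_n S_{n,k} = (B_n B_n^*) S_{n-1,k-1}
B_n the first fact exposes B_{n-1} S_{n-1,k-1}, to which the induction hypothesis applies. The
factor T_{n-1} then meets B_{n-1} B_n and becomes q, while J_n commutes with B_{n-1}^*
(`commute_scaledJM`).

Dividing by [k]!_q over ℤ[X] takes two more inputs. Existence of the quotient: B_{n,k} is the sum of
T_w over a symmetric group on k letters times a sum over coset representatives, and the first factor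
x satisfies x^* x = [k]!_q x (`exists_qFactorial_smul_eq`). Cancellation: H_n is free on the T_w,
because it acts on the free module on S_n with T_w sending 1 to w, and it is spanned by n! elements
(`permEval_injective`). Freeness also gives T_{(i,m+1)} = T_m T_{(i,m)} T_m, hence the recursion for
q^n J_n. Finally X is specialised to q and q^k is cancelled. -/

namespace HeckeShuffle

/-! ### Identities between shuffles and Jucys–Murphy elements, from the Hecke relations alone. -/

section Sequences

variable {R : Type*} [CommRing R] {A : Type*} [Ring A] [Algebra R A]

/-- A sequence in an algebra satisfying the Hecke relations, the quadratic one only for indices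
in `{1, …, N - 1}`. -/
structure IsHeckeSeq (q : R) (N : ℕ) (t : ℕ → A) : Prop where
  zero : t 0 = 0
  comm : ∀ i j, i + 1 < j → t i * t j = t j * t i
  braid : ∀ i, t i * (t (i + 1) * t i) = t (i + 1) * (t i * t (i + 1))
  quad : ∀ i, 0 < i → i < N → t i * t i = (q - 1) • t i + q • (1 : A)

/-- `1 + t_{m+k-1} + t_{m+k-1} t_{m+k-2} + ⋯ + t_{m+k-1} ⋯ t_{m+1}`. -/
def descSum (t : ℕ → A) (m : ℕ) : ℕ → A
  | 0 => 0
  | k + 1 => 1 + t (m + k) * descSum t m k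

/-- `1 + t_{m+k-1} + t_{m+k-2} t_{m+k-1} + ⋯ + t_{m+1} ⋯ t_{m+k-1}`. -/
def ascSum (t : ℕ → A) (m : ℕ) : ℕ → A
  | 0 => 0
  | k + 1 => 1 + ascSum t m k * t (m + k)

/-- The rescaled Jucys–Murphy elements `∑_{i<n} q^i T_{(i,n)}`, defined recursively. -/
def scaledJM (q : R) (t : ℕ → A) : ℕ → A
  | 0 => 0
  | n + 1 => q ^ n • t n + t n * (scaledJM q t n * t n)

/-- The product `B_{n,k}^* B_{n,k}`, defined recursively. -/
def shuffleSq (t : ℕ → A) : ℕ → ℕ → A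
  | _, 0 => 1
  | 0, _ + 1 => 0
  | n + 1, k + 1 => ascSum t 0 (n + 1) * (shuffleSq t n k * descSum t 0 (n + 1))

theorem shuffleSq_zero (t : ℕ → A) (n : ℕ) : shuffleSq t n 0 = 1 := by
  cases n <;> rfl

theorem shuffleSq_succ (t : ℕ → A) (n k : ℕ) :
    shuffleSq t n (k + 1) = ascSum t 0 n * (shuffleSq t (n - 1) k * descSum t 0 n) := by
  cases n with
  | zero => simp [shuffleSq, descSum]
  | succ n => simp [shuffleSq]

theorem qInt_zero (q : R) : qInt q 0 = 0 := by simp [qInt]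

theorem qInt_succ (q : R) (k : ℕ) : qInt q (k + 1) = qInt q k + q ^ k := by
  simp [qInt, Finset.sum_range_succ]

theorem qInt_succ' (q : R) (k : ℕ) : qInt q (k + 1) = q * qInt q k + 1 := by
  simp [qInt, Finset.sum_range_succ', Finset.mul_sum, pow_succ']

theorem qInt_add (q : R) (j k : ℕ) : qInt q (j + k) = qInt q j + q ^ j * qInt q k := by
  simp [qInt, Finset.sum_range_add, Finset.mul_sum, pow_add]

theorem qFactorial_succ (q : R) (k : ℕ) :
    qFactorial q (k + 1) = qFactorial q k * qInt q (k + 1) := by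
  simp [qFactorial, Finset.prod_Icc_succ_top]

theorem pow_sub_one_eq (q : R) (k : ℕ) : q ^ k = 1 + (q - 1) * qInt q k := by
  linear_combination qInt_succ' q k - qInt_succ q k

namespace IsHeckeSeq

variable {q : R} {N : ℕ} {t : ℕ → A}

theorem commute_of_lt (h : IsHeckeSeq q N t) {i j : ℕ} (hij : i + 1 < j) : Commute (t i) (t j) :=
  h.comm i j hij

theorem commute_descSum (h : IsHeckeSeq q N t) (m : ℕ) {k j : ℕ} (hj : m + k < j) :
    Commute (t j) (descSum t m k) := by
  induction k with
  | zero => exact Commute.zero_right _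
  | succ k ih =>
    exact (Commute.one_right _).add_right
      ((h.commute_of_lt (by omega)).symm.mul_right (ih (by omega)))

theorem commute_ascSum (h : IsHeckeSeq q N t) (m : ℕ) {k j : ℕ} (hj : m + k < j) :
    Commute (t j) (ascSum t m k) := by
  induction k with
  | zero => exact Commute.zero_right _
  | succ k ih =>
    exact (Commute.one_right _).add_right
      ((ih (by omega)).mul_right (h.commute_of_lt (by omega)).symm)

theorem commute_shuffleSq (h : IsHeckeSeq q N t) {n j : ℕ} (k : ℕ) (hj : n < j) :
    Commute (t j) (shuffleSq t n k) := by
  induction k generalizing n with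
  | zero => rw [shuffleSq_zero]; exact Commute.one_right _
  | succ k ih =>
    rw [shuffleSq_succ]
    exact (h.commute_ascSum 0 (by omega)).mul_right
      ((ih (by omega)).mul_right (h.commute_descSum 0 (by omega)))

theorem commute_scaledJM_of_gt (h : IsHeckeSeq q N t) {n j : ℕ} (hj : n < j) :
    Commute (t j) (scaledJM q t n) := by
  induction n with
  | zero => exact Commute.zero_right _
  | succ n ih =>
    have hc := (h.commute_of_lt (i := n) (j := j) (by omega)).symm
    exact (hc.smul_right _).add_right (hc.mul_right ((ih (by omega)).mul_right hc))

/-- Two successive bottom-to-random moves absorb the top generator as the scalar q. The braid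
relation reduces this to the previous generator. -/
theorem mul_descSum_mul_descSum (h : IsHeckeSeq q N t) (m k : ℕ) (hk : m + k < N) :
    t (m + k) * (descSum t m k * descSum t m (k + 1)) =
      q • (descSum t m k * descSum t m (k + 1)) := by
  induction k with
  | zero => simp [descSum]
  | succ k ih =>
    have hq := h.quad (m + (k + 1)) (by omega) hk
    have hb := h.braid (m + k)
    have hc := (h.commute_descSum m (k := k) (j := m + (k + 1)) (by omega)).eq
    have ih := ih (by omega)
    simp only [descSum] at ih ⊢
    rw [show m + k + 1 = m + (k + 1) by omega] at hb
    generalize t (m + (k + 1)) = T at *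
    generalize t (m + k) = S at *
    generalize descSum t m k = C at *
    -- The braid relation turns `T * S * T` into `S * T * S`, whose last `S` acts as q by `ih`.
    have key : (T * S * T - q • (S * T)) * (C * (1 + S * C)) = 0 := by
      have : T * S * T * (C * (1 + S * C)) = S * T * (S * (C * (1 + S * C))) := by
        rw [mul_assoc T, ← hb]; simp only [mul_assoc]
      rw [sub_mul, this, ih]
      simp only [mul_smul_comm, smul_mul_assoc, mul_assoc, sub_self]
    linear_combination (norm := (simp only [mul_add, add_mul, sub_mul, mul_one, one_mul,
      mul_assoc, smul_mul_assoc, smul_add]; module))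
      key + hq * (1 + S * C) + (q • S - T * S) * hc * (1 + S * C)

/-- Expand (1 + TC)(1 + C'T) and put the induction hypothesis for CC' between the two T's. By `key`
the conjugated middle term is (C' - 1)T(C - 1), which cancels the cross terms. The quadratic
relation applied to [n+1]_q T² raises the q-integer and supplies the linear term of the next
Jucys–Murphy element. -/
theorem descSum_mul_ascSum (h : IsHeckeSeq q N t) (n : ℕ) (hn : n < N) :
    descSum t 0 (n + 1) * ascSum t 0 (n + 1) =
      ascSum t 0 n * (t n * descSum t 0 n) + qInt q (n + 1) • (1 : A) +
        scaledJM q t (n + 1) := by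
  induction n with
  | zero => simp [descSum, ascSum, scaledJM, h.zero, qInt]
  | succ n ih =>
    have hq := h.quad (n + 1) (by omega) hn
    have hb := h.braid n
    have hc := (h.commute_descSum 0 (k := n) (j := n + 1) (by omega)).eq
    have hc' := (h.commute_ascSum 0 (k := n) (j := n + 1) (by omega)).eq
    have ih := ih (by omega)
    have h1 := qInt_succ' q (n + 1)
    have h2 := pow_sub_one_eq q (n + 1)
    have e1 : descSum t 0 (n + 1) = 1 + t n * descSum t 0 n := by simp [descSum]
    have e2 : ascSum t 0 (n + 1) = 1 + ascSum t 0 n * t n := by simp [ascSum]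
    have e3 : descSum t 0 (n + 1 + 1) = 1 + t (n + 1) * descSum t 0 (n + 1) := by
      simp [descSum]
    have e4 : ascSum t 0 (n + 1 + 1) = 1 + ascSum t 0 (n + 1) * t (n + 1) := by simp [ascSum]
    have e5 : scaledJM q t (n + 1 + 1) =
      q ^ (n + 1) • t (n + 1) + t (n + 1) * (scaledJM q t (n + 1) * t (n + 1)) := rfl
    rw [e3, e4, e5, h1, h2]
    generalize t (n + 1) = T at *
    generalize t n = S at *
    generalize qInt q (n + 1) = a at *
    generalize scaledJM q t (n + 1) = Y at *
    have key : T * (ascSum t 0 n * (S * descSum t 0 n)) * T =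
        (ascSum t 0 (n + 1) - 1) * T * (descSum t 0 (n + 1) - 1) := by
      rw [e1, e2, add_sub_cancel_left, add_sub_cancel_left]
      calc T * (ascSum t 0 n * (S * descSum t 0 n)) * T
          = (T * ascSum t 0 n) * S * (descSum t 0 n * T) := by simp only [mul_assoc]
        _ = ascSum t 0 n * (T * (S * T)) * descSum t 0 n := by
          rw [hc', ← hc]; simp only [mul_assoc]
        _ = _ := by rw [← hb]; simp only [mul_assoc]
    generalize descSum t 0 (n + 1) = C at *
    generalize ascSum t 0 (n + 1) = C' at *
    linear_combination (norm := (simp only [mul_add, add_mul, mul_sub, sub_mul, mul_one, one_mul,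
      mul_assoc, smul_mul_assoc, mul_smul_comm, smul_add]; module))
      T * ih * T + key + a • hq

theorem commute_scaledJM (h : IsHeckeSeq q N t) {n i : ℕ} (hi : i < n) (hn : n < N) :
    Commute (t i) (scaledJM q t (n + 1)) := by
  induction n generalizing i with
  | zero => omega
  | succ n ih =>
    have e5 : scaledJM q t (n + 1 + 1) =
      q ^ (n + 1) • t (n + 1) + t (n + 1) * (scaledJM q t (n + 1) * t (n + 1)) := rfl
    have e6 : scaledJM q t (n + 1) = q ^ n • t n + t n * (scaledJM q t n * t n) := rfl
    rcases Nat.lt_succ_iff_lt_or_eq.1 hi with hi | rfl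
    · have hc := h.commute_of_lt (i := i) (j := n + 1) (by omega)
      exact e5 ▸ (hc.smul_right _).add_right (hc.mul_right ((ih hi (by omega)).mul_right hc))
    -- For the top index, two levels of the recursion are opened; `k1` treats the part containing
    -- `Y`, and `k2`, `k3` the linear part, on which the (q - 1)-terms agree.
    · have hb := h.braid i
      have hq := h.quad (i + 1) (by omega) hn
      have hc := (h.commute_scaledJM_of_gt (n := i) (j := i + 1) (by omega)).eq
      change _ * _ = _ * _
      rw [e5, e6]
      generalize t (i + 1) = T at *
      generalize t i = S at *
      generalize scaledJM q t i = Y at *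
      have k1 : S * (T * (S * (Y * (S * T)))) = T * (S * (Y * (S * (T * S)))) := by
        calc S * (T * (S * (Y * (S * T)))) = (S * (T * S)) * (Y * (S * T)) := by
              simp only [mul_assoc]
          _ = T * (S * ((T * Y) * (S * T))) := by rw [hb]; simp only [mul_assoc]
          _ = T * (S * (Y * (T * (S * T)))) := by rw [hc]; simp only [mul_assoc]
          _ = _ := by rw [← hb]
      have k2 : S * (T * (S * T)) = (q - 1) • (T * (S * T)) + q • (T * S) := by
        calc S * (T * (S * T)) = (S * (T * S)) * T := by simp only [mul_assoc]
          _ = T * (S * (T * T)) := by rw [hb]; simp only [mul_assoc]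
          _ = _ := by rw [hq]; simp only [mul_add, mul_smul_comm, mul_one]
      have k3 : T * (S * (T * S)) = (q - 1) • (T * (S * T)) + q • (S * T) := by
        calc T * (S * (T * S)) = T * (T * (S * T)) := by rw [hb]
          _ = (T * T) * (S * T) := by simp only [mul_assoc]
          _ = _ := by rw [hq]; simp only [add_mul, smul_mul_assoc, one_mul]
      linear_combination (norm := (simp only [mul_add, add_mul,
        mul_assoc, smul_mul_assoc, mul_smul_comm, smul_add]; module))
        k1 + q ^ i • k2 - q ^ i • k3

theorem commute_ascSum_of_forall {x : A} (n : ℕ) (hx : ∀ i < n, Commute (t i) x) :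
    Commute (ascSum t 0 n) x := by
  induction n with
  | zero => exact Commute.zero_left _
  | succ n ih =>
    refine (Commute.one_left _).add_left (Commute.mul_left (ih fun i hi => hx i (by omega)) ?_)
    simpa using hx n (by omega)

theorem commute_scaledJM_ascSum (h : IsHeckeSeq q N t) {n : ℕ} (hn : n < N) :
    Commute (ascSum t 0 n) (scaledJM q t (n + 1)) :=
  commute_ascSum_of_forall n fun _ hi => h.commute_scaledJM hi hn

/-- The recursion for `B_{n,k}^* B_{n,k}`, multiplied by `q^k`. -/
theorem pow_smul_descSum_mul_shuffleSq (h : IsHeckeSeq q N t) (m k : ℕ) (hN : m + k ≤ N) :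
    q ^ k • (descSum t 0 (m + k) * shuffleSq t (m + k) k) =
      (q ^ (2 * k) • shuffleSq t (m + k - 1) k +
        qInt q k • (((q ^ k * qInt q (m + 1)) • (1 : A) + q • scaledJM q t (m + k)) *
          shuffleSq t (m + k - 1) (k - 1))) * descSum t 0 (m + k) := by
  induction k with
  | zero => simp [shuffleSq_zero, qInt_zero]
  | succ k ih =>
    have ih := ih (by omega)
    rw [show m + (k + 1) = m + k + 1 by omega, Nat.add_sub_cancel, Nat.add_sub_cancel]
    rw [show 2 * (k + 1) = 2 * k + 2 by omega, pow_add q (2 * k) 2, pow_succ q k]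
    have hA := h.descSum_mul_ascSum (m + k) (by omega)
    have hK : scaledJM q t (m + k + 1) = q ^ (m + k) • t (m + k) +
      t (m + k) * (scaledJM q t (m + k) * t (m + k)) := rfl
    have hT := h.mul_descSum_mul_descSum 0 (m + k) (by omega)
    rw [zero_add] at hT
    have hJ := (h.commute_scaledJM_ascSum (n := m + k) (by omega)).eq
    have hP1 : shuffleSq t (m + k + 1) (k + 1) =
      ascSum t 0 (m + k + 1) * (shuffleSq t (m + k) k * descSum t 0 (m + k + 1)) := rfl
    have hP2 := shuffleSq_succ t (m + k) k
    -- The factor [k]_q covers k = 0, where the truncated `k - 1` is meaningless.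
    have hP3 : qInt q k • shuffleSq t (m + k) k = qInt q k • (ascSum t 0 (m + k) *
        (shuffleSq t (m + k - 1) (k - 1) * descSum t 0 (m + k))) := by
      cases k with
      | zero => simp [qInt_zero]
      | succ k => rw [shuffleSq_succ]; rfl
    -- `t (m + k)` commutes past elements built from generators two or more steps below; for m + k =
    -- 0 both sides vanish.
    have f1 : ∀ j, t (m + k) * (shuffleSq t (m + k - 1) j *
        (descSum t 0 (m + k) * descSum t 0 (m + k + 1))) =
        shuffleSq t (m + k - 1) j * (t (m + k) *
          (descSum t 0 (m + k) * descSum t 0 (m + k + 1))) := by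
      intro j
      rcases Nat.eq_zero_or_pos (m + k) with h0 | h0
      · simp [h0, descSum]
      · rw [← mul_assoc, (h.commute_shuffleSq (n := m + k - 1) (j := m + k) j (by omega)).eq,
          mul_assoc]
    have g1 := f1 k
    have g2 := f1 (k - 1)
    have hr := pow_sub_one_eq q (m + 1)
    have hs : q * q ^ (m + k) = q ^ k * (1 + (q - 1) * qInt q (m + 1)) := by
      rw [← hr]; ring
    rw [qInt_succ]
    rw [show m + k + 1 = k + (m + 1) by omega, qInt_add, show k + (m + 1) = m + k + 1 by omega]
      at hA
    rw [mul_comm 2 k, pow_mul] at ih ⊢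
    rw [hT] at g1 g2
    clear hT f1
    rw [hP1]
    generalize shuffleSq t (m + k) (k + 1) = W at *
    generalize shuffleSq t (m + k) k = X at *
    generalize shuffleSq t (m + k - 1) k = Y at *
    generalize shuffleSq t (m + k - 1) (k - 1) = Z at *
    generalize scaledJM q t (m + k + 1) = K' at *
    generalize scaledJM q t (m + k) = K at *
    generalize descSum t 0 (m + k + 1) = B at *
    generalize ascSum t 0 (m + k + 1) = B' at *
    generalize descSum t 0 (m + k) = C at *
    generalize ascSum t 0 (m + k) = C' at *
    generalize t (m + k) = T at *
    generalize qInt q k = y at *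
    generalize qInt q (m + 1) = x at *
    generalize q ^ (m + k) = s at *
    generalize q ^ k = p at *
    -- On Z C B the generator T is the scalar q, so the recursion K' = sT + TKT lets K' replace q T
    -- K, with qs rewritten by `hs`.
    have f3 : q • (T * (K * (Z * (C * B)))) =
        K' * (Z * (C * B)) - (p * (1 + (q - 1) * x)) • (Z * (C * B)) := by
      rw [hK, ← hs]
      linear_combination (norm := (simp only [add_mul, mul_assoc,
        smul_mul_assoc, mul_smul_comm]; module)) (-s) • g2 - T * K * g2
    linear_combination (norm := (simp only [mul_add, add_mul, mul_sub, mul_one,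
        one_mul, mul_assoc, smul_mul_assoc, mul_smul_comm, smul_add]; module))
      (p * q) • hA * (X * B) + q • (C' * T) * ih * B + (p ^ 2 * q) • C' * g1 +
        (y * p * q * x) • C' * g2 + (q * y) • C' * f3 + (q * y) • hJ * (Z * (C * B)) -
        q • K' * hP3 * B - (p ^ 2 * q ^ 2) • hP2 * B -
        (q ^ 2 * p * x - q * p * (1 + (q - 1) * x)) • hP3 * B

end IsHeckeSeq

end Sequences

/-! ### Divisibility of B_{n,k}^* B_{n,k} by the q-factorial. -/

section Divisibility

variable {R : Type*} [CommRing R] {A : Type*} [Ring A] [Algebra R A]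

/-- The product `t_m t_{m+1} ⋯ t_{m+k-1}`. -/
def chain (t : ℕ → A) (m : ℕ) : ℕ → A
  | 0 => 1
  | k + 1 => chain t m k * t (m + k)

/-- The sum over minimal coset representatives of `S_m × S_k` in `S_{m+k}`, defined recursively. -/
def cosetSum (t : ℕ → A) : ℕ → ℕ → A
  | 0, _ => 1
  | _ + 1, 0 => 1
  | m + 1, k + 1 => cosetSum t (m + 1) k + chain t (m + 1) (k + 1) * cosetSum t m (k + 1)

/-- The sum over the symmetric group on the letters `m + 1, …, m + k`, as a product. -/
def blockSum (t : ℕ → A) (m : ℕ) : ℕ → A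
  | 0 => 1
  | k + 1 => blockSum t m k * descSum t m (k + 1)

/-- The product `B_{m+1} ⋯ B_{m+k}`. -/
def bottomProd (t : ℕ → A) (m : ℕ) : ℕ → A
  | 0 => 1
  | k + 1 => bottomProd t m k * descSum t 0 (m + k + 1)

theorem cosetSum_zero (t : ℕ → A) (m : ℕ) : cosetSum t m 0 = 1 := by
  cases m <;> rw [cosetSum]

namespace IsHeckeSeq

variable {q : R} {N : ℕ} {t : ℕ → A}

theorem commute_chain (h : IsHeckeSeq q N t) (m : ℕ) {k j : ℕ} (hj : m + k < j) :
    Commute (t j) (chain t m k) := by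
  induction k with
  | zero => exact Commute.one_right _
  | succ k ih => exact (ih (by omega)).mul_right (h.commute_of_lt (by omega)).symm

theorem commute_cosetSum (h : IsHeckeSeq q N t) {m k j : ℕ} (hj : m + k < j) :
    Commute (t j) (cosetSum t m k) := by
  induction m generalizing k with
  | zero => rw [cosetSum]; exact Commute.one_right _
  | succ m ihm =>
    induction k with
    | zero => rw [cosetSum]; exact Commute.one_right _
    | succ k ihk =>
      rw [cosetSum]
      refine (ihk (by omega)).add_right (Commute.mul_right ?_ (ihm (by omega)))
      exact h.commute_chain _ (by omega)

theorem commute_blockSum (h : IsHeckeSeq q N t) (m : ℕ) {k j : ℕ} (hj : m + k < j) :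
    Commute (t j) (blockSum t m k) := by
  induction k with
  | zero => exact Commute.one_right _
  | succ k ih => exact (ih (by omega)).mul_right (h.commute_descSum m (by omega))

/-- Moving a generator leftwards across the chain raises its index by one, by the braid relation. -/
theorem chain_mul_descSum (h : IsHeckeSeq q N t) (m k : ℕ) :
    chain t (m + 1) k * descSum t m k = descSum t (m + 1) k * chain t (m + 1) k := by
  induction k with
  | zero => simp [descSum]
  | succ k ih =>
    cases k with
    | zero => simp [descSum]
    | succ k =>
      have hb := h.braid (m + 1 + k)
      have h1 := (h.commute_chain (m + 1) (k := k) (j := m + 1 + (k + 1)) (by omega)).eq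
      have h2 := (h.commute_descSum m (k := k + 1) (j := m + 1 + (k + 1)) (by omega)).eq
      rw [descSum.eq_2 t m, descSum.eq_2 t (m + 1), chain.eq_2 t (m + 1) (k + 1)]
      rw [show m + (k + 1) = m + 1 + k by omega]
      have hc : chain t (m + 1) (k + 1) = chain t (m + 1) k * t (m + 1 + k) := rfl
      rw [show m + 1 + k + 1 = m + 1 + (k + 1) by omega] at hb
      generalize t (m + 1 + (k + 1)) = T at *
      generalize t (m + 1 + k) = S at *
      generalize descSum t m (k + 1) = C at *
      generalize chain t (m + 1) (k + 1) = c at *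
      rw [mul_add, add_mul, mul_one, one_mul]
      congr 1
      calc c * T * (S * C) = chain t (m + 1) k * (S * (T * S)) * C := by
            rw [hc]; simp only [mul_assoc]
        _ = (chain t (m + 1) k * T) * S * (T * C) := by rw [hb]; simp only [mul_assoc]
        _ = T * (c * C) * T := by rw [← h1, h2, hc]; simp only [mul_assoc]
        _ = _ := by rw [ih]; simp only [mul_assoc]

/-- Both sides expand by the Pascal-type recursion of `cosetSum`; `chain_mul_descSum` aligns the
shifted blocks. This is the exchange that sorts B_{m+1} ⋯ B_{m+k} into block sum times coset sum. -/
theorem cosetSum_mul_descSum (h : IsHeckeSeq q N t) (m k : ℕ) :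
    cosetSum t m k * descSum t 0 (m + k + 1) = descSum t m (k + 1) * cosetSum t m (k + 1) := by
  induction m generalizing k with
  | zero => simp [cosetSum]
  | succ m ihm =>
    induction k with
    | zero =>
      have := ihm 0
      rw [cosetSum_zero, one_mul, add_zero] at this
      have e : descSum t m (0 + 1) = 1 := by simp [descSum]
      rw [e, one_mul] at this
      rw [cosetSum_zero, one_mul, cosetSum, cosetSum_zero, add_zero, descSum, this]
      simp [descSum, chain]
    | succ k ihk =>
      have h1 := (h.commute_cosetSum (m := m + 1) (k := k) (j := m + 1 + (k + 1)) (by omega)).eq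
      have h2 := (h.commute_cosetSum (m := m) (k := k + 1) (j := m + 1 + (k + 1))
        (by omega)).eq
      have ihm := ihm (k + 1)
      have hc := h.chain_mul_descSum m (k + 1 + 1)
      have e1 : descSum t 0 (m + 1 + (k + 1) + 1) =
          1 + t (m + 1 + (k + 1)) * descSum t 0 (m + 1 + (k + 1)) := by simp [descSum]
      have e2 : descSum t (m + 1) (k + 1 + 1) =
          1 + t (m + 1 + (k + 1)) * descSum t (m + 1) (k + 1) := rfl
      have e3 : cosetSum t (m + 1) (k + 1 + 1) =
        cosetSum t (m + 1) (k + 1) + chain t (m + 1) (k + 1 + 1) * cosetSum t m (k + 1 + 1) := by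
        rw [cosetSum]
      have e4 : cosetSum t (m + 1) (k + 1) =
        cosetSum t (m + 1) k + chain t (m + 1) (k + 1) * cosetSum t m (k + 1) := by
        rw [cosetSum]
      have e5 : chain t (m + 1) (k + 1 + 1) = chain t (m + 1) (k + 1) * t (m + 1 + (k + 1)) := rfl
      rw [show m + (k + 1) + 1 = m + 1 + (k + 1) by omega] at ihm
      rw [show m + 1 + k + 1 = m + 1 + (k + 1) by omega] at ihk
      rw [e3, mul_add, ← mul_assoc (descSum t (m + 1) (k + 1 + 1)), ← hc, mul_assoc, ← ihm, e2,
        add_mul, one_mul, mul_assoc, ← ihk, e1, mul_add, mul_one, add_assoc (cosetSum t (m + 1) (k + 1))]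
      congr 1
      rw [← mul_assoc (t (m + 1 + (k + 1))), h1, e5]
      simp only [mul_assoc]
      rw [← mul_assoc (t (m + 1 + (k + 1))), h2, e4, add_mul]
      simp only [mul_assoc]

theorem bottomProd_eq (h : IsHeckeSeq q N t) (m k : ℕ) :
    bottomProd t m k = blockSum t m k * cosetSum t m k := by
  induction k with
  | zero => simp [bottomProd, blockSum, cosetSum_zero]
  | succ k ih =>
    rw [bottomProd, ih, blockSum, mul_assoc, h.cosetSum_mul_descSum, mul_assoc]

/-- The block sum spans the trivial representation of its parabolic subalgebra; only the top
generator needs the two-move absorption. -/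
theorem mul_blockSum (h : IsHeckeSeq q N t) (m k : ℕ) {i : ℕ} (hm : m < i) (hi : i < m + k)
    (hN : m + k ≤ N) : t i * blockSum t m k = q • blockSum t m k := by
  induction k with
  | zero => omega
  | succ k ih =>
    rcases Nat.lt_or_ge i (m + k) with hik | hik
    · rw [blockSum, ← mul_assoc, ih hik (by omega), smul_mul_assoc]
    · obtain rfl : i = m + k := by omega
      cases k with
      | zero => omega
      | succ k =>
        rw [blockSum, blockSum, mul_assoc, ← mul_assoc (t _),
          (h.commute_blockSum m (by omega)).eq, mul_assoc,
          h.mul_descSum_mul_descSum m (k + 1) (by omega), mul_smul_comm]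

theorem ascSum_mul_blockSum (h : IsHeckeSeq q N t) (m k : ℕ) (hN : m + k ≤ N) {j : ℕ}
    (hj : j ≤ k) : ascSum t m j * blockSum t m k = qInt q j • blockSum t m k := by
  induction j with
  | zero => simp [ascSum, qInt_zero]
  | succ j ih =>
    rw [ascSum, add_mul, one_mul, mul_assoc, qInt_succ', add_smul, one_smul, add_comm]
    cases j with
    | zero => simp [ascSum, qInt_zero]
    | succ j =>
      rw [h.mul_blockSum m k (by omega) (by omega) hN, mul_smul_comm, ih (by omega), smul_smul]

theorem op_ascSum {σ : A →ₐ[R] Aᵐᵒᵖ} (hσ : ∀ i, σ (t i) = MulOpposite.op (t i)) (m k : ℕ) :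
    σ (descSum t m k) = MulOpposite.op (ascSum t m k) := by
  induction k with
  | zero => simp [descSum, ascSum]
  | succ k ih => simp [descSum, ascSum, ih, hσ]

theorem unop_bottomProd_mul {σ : A →ₐ[R] Aᵐᵒᵖ} (hσ : ∀ i, σ (t i) = MulOpposite.op (t i))
    (m k : ℕ) : (σ (bottomProd t m k)).unop * bottomProd t m k = shuffleSq t (m + k) k := by
  induction k with
  | zero => simp [bottomProd, shuffleSq_zero]
  | succ k ih =>
    rw [bottomProd, ← add_assoc, shuffleSq, ← ih]
    simp [op_ascSum hσ, mul_assoc]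

theorem unop_blockSum_mul (h : IsHeckeSeq q N t) {σ : A →ₐ[R] Aᵐᵒᵖ}
    (hσ : ∀ i, σ (t i) = MulOpposite.op (t i)) (m k : ℕ) (hN : m + k ≤ N) :
    (σ (blockSum t m k)).unop * blockSum t m k = qFactorial q k • blockSum t m k := by
  induction k with
  | zero => simp [blockSum, qFactorial]
  | succ k ih =>
    have e : (σ (blockSum t m (k + 1))).unop * blockSum t m (k + 1) =
        ascSum t m (k + 1) * (((σ (blockSum t m k)).unop * blockSum t m k) *
          descSum t m (k + 1)) := by
      simp [blockSum, op_ascSum hσ, mul_assoc]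
    rw [e, ih (by omega), smul_mul_assoc, mul_smul_comm]
    change _ • (_ * blockSum t m (k + 1)) = _
    rw [h.ascSum_mul_blockSum m (k + 1) hN le_rfl, smul_smul, qFactorial_succ]

theorem shuffleSq_of_lt {n k : ℕ} (hk : n < k) : shuffleSq t n k = 0 := by
  induction k generalizing n with
  | zero => omega
  | succ k ih =>
    cases n with
    | zero => rfl
    | succ n => rw [shuffleSq, ih (by omega), zero_mul, mul_zero]

theorem exists_qFactorial_smul_eq (h : IsHeckeSeq q N t) {σ : A →ₐ[R] Aᵐᵒᵖ}
    (hσ : ∀ i, σ (t i) = MulOpposite.op (t i)) {n : ℕ} (k : ℕ) (hN : n ≤ N) :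
    ∃ r : A, qFactorial q k • r = shuffleSq t n k := by
  rcases Nat.lt_or_ge n k with hk | hk
  · exact ⟨0, by rw [shuffleSq_of_lt hk, smul_zero]⟩
  · obtain ⟨m, rfl⟩ := Nat.exists_eq_add_of_le' hk
    refine ⟨(σ (cosetSum t m k)).unop * (blockSum t m k * cosetSum t m k), ?_⟩
    rw [← unop_bottomProd_mul hσ, h.bottomProd_eq, map_mul, MulOpposite.unop_mul,
      mul_assoc, ← mul_assoc (MulOpposite.unop (σ (blockSum t m k))), h.unop_blockSum_mul hσ m k hN, smul_mul_assoc,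
      mul_smul_comm]

end IsHeckeSeq

end Divisibility

/-! ### The regular action on the free module on S_n, with T_w sending 1 to w. -/

section Representation

variable {R : Type*} [CommRing R]

theorem T_of_mem (q : R) {n i : ℕ} (h : i ∈ Finset.Ico 1 n) : T q n i = gen q n ⟨i, h⟩ :=
  dif_pos h

theorem T_of_not_mem (q : R) {n i : ℕ} (h : i ∉ Finset.Ico 1 n) : T q n i = 0 :=
  dif_neg h

theorem T_coe (q : R) {n : ℕ} (i : Gen n) : T q n i = gen q n i := T_of_mem q i.2

theorem isHeckeSeq_T (q : R) (n : ℕ) : IsHeckeSeq q n (T q n) where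
  zero := T_of_not_mem q (by simp)
  comm i j hij := by
    by_cases hi : i ∈ Finset.Ico 1 n
    · by_cases hj : j ∈ Finset.Ico 1 n
      · rw [T_of_mem q hi, T_of_mem q hj]
        exact gen_comm q n _ _ (Or.inl hij)
      · rw [T_of_not_mem q hj, mul_zero, zero_mul]
    · rw [T_of_not_mem q hi, mul_zero, zero_mul]
  braid i := by
    by_cases hi : i ∈ Finset.Ico 1 n
    · by_cases hj : i + 1 ∈ Finset.Ico 1 n
      · rw [T_of_mem q hi, T_of_mem q hj, ← mul_assoc, ← mul_assoc]
        exact gen_braid q n _ _ rfl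
      · simp [T_of_not_mem q hj]
    · simp [T_of_not_mem q hi]
  quad i h0 hn := by
    have hi : i ∈ Finset.Ico 1 n := Finset.mem_Ico.2 ⟨h0, hn⟩
    rw [T_of_mem q hi, ← pow_two, gen_sq, Algebra.algebraMap_eq_smul_one]

open Equiv (Perm swap)

section Action

variable {n : ℕ}

/-- The operator by which the generator attached to the transposition `(a, b)` acts on the free
module on the symmetric group. -/
noncomputable def permAct (q : R) (a b : Fin n) : Module.End R (Perm (Fin n) →₀ R) :=
  Finsupp.linearCombination R fun v =>
    if v⁻¹ a < v⁻¹ b then Finsupp.single (swap a b * v) 1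
    else q • Finsupp.single (swap a b * v) 1 + (q - 1) • Finsupp.single v 1

theorem permAct_single (q : R) (a b : Fin n) (v : Perm (Fin n)) :
    permAct q a b (Finsupp.single v 1) =
      if v⁻¹ a < v⁻¹ b then Finsupp.single (swap a b * v) 1
      else q • Finsupp.single (swap a b * v) 1 + (q - 1) • Finsupp.single v 1 := by
  simp [permAct]

theorem permAct_sq (q : R) {a b : Fin n} (hab : a ≠ b) :
    permAct q a b ^ 2 = (q - 1) • permAct q a b + algebraMap R _ q := by
  refine Finsupp.lhom_ext' fun v => LinearMap.ext_ring ?_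
  simp only [pow_two, LinearMap.comp_apply, Finsupp.lsingle_apply, Module.End.mul_apply,
    LinearMap.add_apply, LinearMap.smul_apply, Module.algebraMap_end_apply]
  have hne : v⁻¹ a ≠ v⁻¹ b := fun h => hab (v⁻¹.injective h)
  rcases hne.lt_or_gt with h | h
  · simp only [permAct_single, mul_inv_rev, Equiv.swap_inv,
      Perm.mul_apply, Equiv.swap_apply_left, Equiv.swap_apply_right, Equiv.swap_mul_self_mul,
      if_true, if_false, h, h.not_gt]
    module
  · simp only [permAct_single, map_add, map_smul, mul_inv_rev, Equiv.swap_inv,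
      Perm.mul_apply, Equiv.swap_apply_left, Equiv.swap_apply_right, Equiv.swap_mul_self_mul,
      if_true, if_false, h, h.not_gt]
    module

theorem permAct_comm (q : R) {a b c d : Fin n} (hac : a ≠ c) (had : a ≠ d) (hbc : b ≠ c)
    (hbd : b ≠ d) : permAct q a b * permAct q c d = permAct q c d * permAct q a b := by
  refine Finsupp.lhom_ext' fun v => LinearMap.ext_ring ?_
  simp only [LinearMap.comp_apply, Finsupp.lsingle_apply, Module.End.mul_apply]
  have hs : swap a b * (swap c d * v) = swap c d * (swap a b * v) := by
    rw [← mul_assoc, ← mul_assoc, Equiv.mul_swap_eq_swap_mul,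
      Equiv.swap_apply_of_ne_of_ne hac.symm hbc.symm, Equiv.swap_apply_of_ne_of_ne had.symm hbd.symm]
  have e1 := Equiv.swap_apply_of_ne_of_ne hac.symm hbc.symm
  have e2 := Equiv.swap_apply_of_ne_of_ne had.symm hbd.symm
  have e3 := Equiv.swap_apply_of_ne_of_ne hac had
  have e4 := Equiv.swap_apply_of_ne_of_ne hbc hbd
  by_cases h1 : v⁻¹ a < v⁻¹ b <;> by_cases h2 : v⁻¹ c < v⁻¹ d <;>
    simp only [permAct_single, map_add, map_smul, mul_inv_rev, Equiv.swap_inv, Perm.mul_apply,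
      if_true, if_false, h1, h2,
      e1, e2, e3, e4, hs] <;>
    module

theorem permAct_braid (q : R) {a b c : Fin n} (hab : a ≠ b) (hac : a ≠ c) (hbc : b ≠ c) :
    permAct q a b * permAct q b c * permAct q a b =
      permAct q b c * permAct q a b * permAct q b c := by
  refine Finsupp.lhom_ext' fun v => LinearMap.ext_ring ?_
  simp only [LinearMap.comp_apply, Finsupp.lsingle_apply, Module.End.mul_apply]
  have hs : swap a b * (swap b c * (swap a b * v)) = swap b c * (swap a b * (swap b c * v)) := by
    rw [← mul_assoc, Equiv.mul_swap_eq_swap_mul, Equiv.swap_apply_right,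
      Equiv.swap_apply_of_ne_of_ne hac.symm hbc.symm, mul_assoc, Equiv.swap_mul_self_mul,
      ← mul_assoc, Equiv.mul_swap_eq_swap_mul, Equiv.swap_apply_left,
      Equiv.swap_apply_of_ne_of_ne hab hac, mul_assoc, Equiv.swap_mul_self_mul]
  have e1 := Equiv.swap_apply_of_ne_of_ne hab hac
  have e2 := Equiv.swap_apply_of_ne_of_ne hac.symm hbc.symm
  have n1 : v⁻¹ a ≠ v⁻¹ b := fun h => hab (v⁻¹.injective h)
  have n2 : v⁻¹ a ≠ v⁻¹ c := fun h => hac (v⁻¹.injective h)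
  have n3 : v⁻¹ b ≠ v⁻¹ c := fun h => hbc (v⁻¹.injective h)
  -- Of the eight sign patterns, two are cyclic and contradictory; the other six are the orderings
  -- of three positions.
  rcases n1.lt_or_gt with h1 | h1 <;> rcases n2.lt_or_gt with h2 | h2 <;>
    rcases n3.lt_or_gt with h3 | h3 <;>
    first
    | exact absurd (h1.trans (h3.trans h2)) (lt_irrefl _)
    | exact absurd (h1.trans (h2.trans h3)) (lt_irrefl _)
    | (simp only [permAct_single, map_add, map_smul, mul_inv_rev, Equiv.swap_inv,
      Perm.mul_apply, Equiv.swap_apply_left, Equiv.swap_apply_right, Equiv.swap_mul_self_mul,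
      if_true, if_false, h1, h2, h3,
        h1.not_gt, h2.not_gt, h3.not_gt, e1, e2, hs]
       try module)

end Action

theorem letter_ne_nextLetter {n : ℕ} (i : Gen n) : letter i ≠ nextLetter i := by
  have := Finset.mem_Ico.1 i.2
  simp only [letter, nextLetter, ne_eq, Fin.mk.injEq]
  omega

theorem letter_lt_nextLetter {n : ℕ} (i : Gen n) : letter i < nextLetter i := by
  have := Finset.mem_Ico.1 i.2
  simp only [letter, nextLetter, Fin.mk_lt_mk]
  omega

/-- The action of the Hecke algebra on the free module on the symmetric group. -/
noncomputable def permRep (q : R) (n : ℕ) : Hecke q n →ₐ[R] Module.End R (Perm (Fin n) →₀ R) :=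
  RingQuot.liftAlgHom R
    ⟨FreeAlgebra.lift R fun i : Gen n => permAct q (letter i) (nextLetter i), by
      intro x y hxy
      cases hxy with
      | quadratic i =>
        simpa only [map_pow, map_add, map_smul, AlgHom.commutes, FreeAlgebra.lift_ι_apply]
          using permAct_sq q (letter_ne_nextLetter i)
      | comm i j hij =>
        have := Finset.mem_Ico.1 i.2
        have := Finset.mem_Ico.1 j.2
        simp only [map_mul, FreeAlgebra.lift_ι_apply]
        apply permAct_comm <;> simp only [letter, nextLetter, ne_eq, Fin.mk.injEq] <;> omega
      | braid i j hij =>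
        have := Finset.mem_Ico.1 i.2
        have := Finset.mem_Ico.1 j.2
        have e : letter j = nextLetter i := by
          simp only [letter, nextLetter, Fin.mk.injEq]
          omega
        simp only [map_mul, FreeAlgebra.lift_ι_apply, e]
        apply permAct_braid <;> simp only [letter, nextLetter, ne_eq, Fin.mk.injEq] <;> omega⟩

theorem permRep_gen (q : R) {n : ℕ} (i : Gen n) :
    permRep q n (gen q n i) = permAct q (letter i) (nextLetter i) := by
  simp [permRep, gen]

/-- The image of the identity permutation under the action of an element. -/
noncomputable def permEval (q : R) (n : ℕ) : Hecke q n →ₗ[R] (Perm (Fin n) →₀ R) :=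
  (LinearMap.applyₗ (Finsupp.single (1 : Perm (Fin n)) (1 : R))).comp (permRep q n).toLinearMap

theorem permEval_apply (q : R) {n : ℕ} (x : Hecke q n) :
    permEval q n x = permRep q n x (Finsupp.single 1 1) := rfl

theorem permEval_one (q : R) (n : ℕ) : permEval q n 1 = Finsupp.single 1 1 := by
  rw [permEval_apply, map_one, Module.End.one_apply]

theorem permEval_gen_mul (q : R) {n : ℕ} (i : Gen n) {x : Hecke q n} {v : Perm (Fin n)}
    (hx : permEval q n x = Finsupp.single v 1) (hv : v⁻¹ (letter i) < v⁻¹ (nextLetter i)) :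
    permEval q n (gen q n i * x) = Finsupp.single (simpleSwap i * v) 1 := by
  rw [permEval_apply] at hx ⊢
  rw [map_mul, Module.End.mul_apply, hx, permRep_gen, permAct_single, if_pos hv, simpleSwap]

theorem simpleSwap_mul_self {n : ℕ} (i : Gen n) : simpleSwap i * simpleSwap i = 1 :=
  Equiv.swap_mul_self _ _

/-- The strong exchange property. -/
theorem exists_list_prod_eq_swap_mul {n : ℕ} (l : List (Gen n)) {a b : Fin n} (hab : a < b)
    (h : (l.map simpleSwap).prod⁻¹ b < (l.map simpleSwap).prod⁻¹ a) :
    ∃ l' : List (Gen n), l'.length + 1 = l.length ∧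
      (l'.map simpleSwap).prod = swap a b * (l.map simpleSwap).prod := by
  induction l generalizing a b with
  | nil => simp at h; exact absurd h hab.not_gt
  | cons j l ih =>
    simp only [List.map_cons, List.prod_cons, mul_inv_rev, Perm.mul_apply] at h ⊢
    have hinv : (simpleSwap j)⁻¹ = simpleSwap j := Equiv.swap_inv _ _
    rw [hinv] at h
    -- If (a, b) is the pair swapped by the first letter, that letter is deleted; otherwise s_j
    -- preserves the order of a < b and the deletion happens in the tail.
    by_cases hj : a = letter j ∧ b = nextLetter j
    · refine ⟨l, by simp, ?_⟩
      rw [hj.1, hj.2, ← mul_assoc]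
      change _ = simpleSwap j * simpleSwap j * _
      rw [simpleSwap_mul_self, one_mul]
    · have hlt : simpleSwap j a < simpleSwap j b := by
        have := Finset.mem_Ico.1 j.2
        simp only [simpleSwap, Equiv.swap_apply_def]
        simp only [letter, nextLetter, Fin.ext_iff, Fin.lt_def] at hj hab ⊢
        split_ifs <;> simp <;> omega
      obtain ⟨l', hl', hp⟩ := ih hlt h
      refine ⟨j :: l', by simp [hl'], ?_⟩
      rw [List.map_cons, List.prod_cons, hp, ← mul_assoc, ← mul_assoc,
        Equiv.mul_swap_eq_swap_mul]
      simp only [← Perm.mul_apply, simpleSwap_mul_self, Perm.one_apply]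

/-- Each letter of a reduced word lengthens the permutation, so only the branch of `permAct` without
scalars occurs: a descent would give a shorter word by the exchange property. -/
theorem permEval_of_isReducedExpr (q : R) {n : ℕ} (l : List (Gen n)) {w : Perm (Fin n)}
    (h : IsReducedExpr w l) : permEval q n (l.map (gen q n)).prod = Finsupp.single w 1 := by
  induction l generalizing w with
  | nil => rw [← h.1]; simp [permEval_one]
  | cons i l ih =>
    have hl : IsReducedExpr (l.map simpleSwap).prod l :=
      ⟨rfl, fun l' hl' => by
        have := h.2 (i :: l') (by rw [← h.1, List.map_cons, List.prod_cons, hl']; simp)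
        simpa using this⟩
    rw [← h.1, List.map_cons, List.prod_cons, List.map_cons, List.prod_cons]
    refine permEval_gen_mul q i (ih hl) ?_
    by_contra hlt
    have hne : (l.map simpleSwap).prod⁻¹ (nextLetter i) ≠ (l.map simpleSwap).prod⁻¹ (letter i) :=
      fun e => letter_ne_nextLetter i ((Equiv.injective _ e).symm)
    obtain ⟨l', hl', hp⟩ := exists_list_prod_eq_swap_mul l (letter_lt_nextLetter i)
      (lt_of_le_of_ne (not_lt.1 hlt) hne)
    have := h.2 l' (by rw [hp, ← h.1]; rfl)
    rw [List.length_cons] at this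
    omega

theorem permEval_Tw (q : R) {n : ℕ} (w : Perm (Fin n)) :
    permEval q n (Tw q w) = Finsupp.single w 1 :=
  permEval_of_isReducedExpr q _ (exists_isReducedExpr w).choose_spec

theorem permEval_surjective (q : R) (n : ℕ) : Function.Surjective (permEval q n) := by
  intro y
  induction y using Finsupp.induction_linear with
  | zero => exact ⟨0, map_zero _⟩
  | add y z hy hz =>
    obtain ⟨y, rfl⟩ := hy
    obtain ⟨z, rfl⟩ := hz
    exact ⟨y + z, map_add _ _ _⟩
  | single w r => exact ⟨r • Tw q w, by rw [map_smul, permEval_Tw]; simp⟩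

end Representation

/-! ### A spanning set of n! elements, and freeness of the Hecke algebra. -/

section Spanning

variable {R : Type*} [CommRing R] {A : Type*} [Ring A] [Algebra R A]

/-- The product `t_n t_{n-1} ⋯ t_{n-k+1}`. -/
def descProd (t : ℕ → A) (n : ℕ) : ℕ → A
  | 0 => 1
  | k + 1 => descProd t n k * t (n - k)

namespace IsHeckeSeq

variable {q : R} {N : ℕ} {t : ℕ → A}

theorem descProd_mul_of_lt (h : IsHeckeSeq q N t) {n k i : ℕ} (hi : i + k < n) :
    descProd t n k * t i = t i * descProd t n k := by
  induction k with
  | zero => simp [descProd]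
  | succ k ih =>
    rw [descProd, mul_assoc, ← h.comm i (n - k) (by omega), ← mul_assoc, ih (by omega), mul_assoc]

theorem descProd_mul_of_gt (h : IsHeckeSeq q N t) {n k i : ℕ} (hk : k ≤ n) (hi : n < i + k)
    (hin : i < n) : descProd t n k * t (i + 1) = t i * descProd t n k := by
  induction k with
  | zero => omega
  | succ k ih =>
    rcases Nat.lt_or_ge n (i + k) with hik | hik
    · rw [descProd, mul_assoc, h.comm (n - k) (i + 1) (by omega), ← mul_assoc,
        ih (by omega) hik, mul_assoc]
    · obtain ⟨k, rfl⟩ : ∃ j, k = j + 1 := ⟨k - 1, by omega⟩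
      rw [descProd, descProd, show n - (k + 1) = i by omega, show n - k = i + 1 by omega,
        mul_assoc, mul_assoc, ← h.braid i, ← mul_assoc, h.descProd_mul_of_lt (by omega)]
      simp only [mul_assoc]

/-- The n + 1 products t_n ⋯ t_{n-k+1} play the role of coset representatives of S_n in S_{n+1}. -/
theorem exists_finset_span (h : IsHeckeSeq q N t) {n : ℕ} (hn : n ≤ N) :
    ∃ s : Finset A, s.card ≤ n.factorial ∧ 1 ∈ Submodule.span R (s : Set A) ∧
      ∀ i, 0 < i → i < n → ∀ x ∈ Submodule.span R (s : Set A),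
        x * t i ∈ Submodule.span R (s : Set A) := by
  classical
  induction n with
  | zero => exact ⟨{1}, by simp, Submodule.subset_span (by simp), fun i h0 h1 => by omega⟩
  | succ n ih =>
    obtain ⟨s, hs, h1, hmul⟩ := ih (by omega)
    set s' := Finset.image₂ (fun w k => w * descProd t n k) s (Finset.range (n + 1))
    have hmem : ∀ k ≤ n, ∀ x ∈ Submodule.span R (s : Set A),
        x * descProd t n k ∈ Submodule.span R (s' : Set A) := by
      intro k hk x hx
      induction hx using Submodule.span_induction with
      | mem x hx =>
        exact Submodule.subset_span (Finset.mem_image₂_of_mem hx (Finset.mem_range.2 (by omega)))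
      | zero => rw [zero_mul]; exact Submodule.zero_mem _
      | add x y _ _ hx hy => rw [add_mul]; exact Submodule.add_mem _ hx hy
      | smul r x _ hx => rw [smul_mul_assoc]; exact Submodule.smul_mem _ r hx
    refine ⟨s', ?_, ?_, ?_⟩
    · refine (Finset.card_image₂_le _ _ _).trans ?_
      rw [Finset.card_range, Nat.factorial_succ, mul_comm]
      exact Nat.mul_le_mul_left _ hs
    · simpa [descProd] using hmem 0 (by omega) 1 h1
    · intro i h0 hi x hx
      induction hx using Submodule.span_induction with
      | mem x hx =>
        obtain ⟨w, hw, k, hk, rfl⟩ := Finset.mem_image₂.1 hx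
        have hk := Finset.mem_range.1 hk
        have hw : w ∈ Submodule.span R (s : Set A) := Submodule.subset_span hw
        rw [mul_assoc]
        -- The generator commutes past the product, extends it, meets its equal last factor
        -- (quadratic relation), or passes through with its index lowered by one.
        rcases lt_trichotomy (i + k) n with hik | hik | hik
        · rw [h.descProd_mul_of_lt hik, ← mul_assoc]
          exact hmem k (by omega) _ (hmul i h0 (by omega) w hw)
        · have := hmem (k + 1) (by omega) w hw
          rwa [descProd, show n - k = i by omega] at this
        · rcases Nat.lt_or_ge (n + 1) (i + k) with hik' | hik'
          · obtain ⟨i, rfl⟩ : ∃ j, i = j + 1 := ⟨i - 1, by omega⟩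
            rw [h.descProd_mul_of_gt (by omega) (by omega) (by omega), ← mul_assoc]
            exact hmem k (by omega) _ (hmul i (by omega) (by omega) w hw)
          · obtain ⟨k, rfl⟩ : ∃ j, k = j + 1 := ⟨k - 1, by omega⟩
            have e : w * (descProd t n (k + 1) * t i) =
                (q - 1) • (w * descProd t n (k + 1)) + q • (w * descProd t n k) := by
              rw [descProd, show n - k = i by omega, mul_assoc, h.quad i h0 (by omega)]
              simp only [mul_add, mul_smul_comm, mul_one]
            rw [e]
            exact Submodule.add_mem _ (Submodule.smul_mem _ _ (hmem _ (by omega) w hw))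
              (Submodule.smul_mem _ _ (hmem _ (by omega) w hw))
      | zero => rw [zero_mul]; exact Submodule.zero_mem _
      | add x y _ _ hx hy => rw [add_mul]; exact Submodule.add_mem _ hx hy
      | smul r x _ hx => rw [smul_mul_assoc]; exact Submodule.smul_mem _ r hx

end IsHeckeSeq

theorem hecke_induction {q : R} {n : ℕ} {p : Hecke q n → Prop} (scalar : ∀ r, p (algebraMap R _ r))
    (gen : ∀ i, p (gen q n i)) (mul : ∀ x y, p x → p y → p (x * y))
    (add : ∀ x y, p x → p y → p (x + y)) (x : Hecke q n) : p x := by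
  obtain ⟨x, rfl⟩ := RingQuot.mkAlgHom_surjective R (Rel q n) x
  induction x using FreeAlgebra.induction with
  | grade0 r => rw [AlgHom.commutes]; exact scalar r
  | grade1 i => exact gen i
  | mul x y hx hy => rw [map_mul]; exact mul _ _ hx hy
  | add x y hx hy => rw [map_add]; exact add _ _ hx hy

theorem exists_finset_span_eq_top (q : R) (n : ℕ) :
    ∃ s : Finset (Hecke q n), s.card ≤ n.factorial ∧
      Submodule.span R (s : Set (Hecke q n)) = ⊤ := by
  obtain ⟨s, hs, h1, hmul⟩ := (isHeckeSeq_T q n).exists_finset_span le_rfl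
  refine ⟨s, hs, Submodule.eq_top_iff'.2 fun x => ?_⟩
  have key : ∀ y ∈ Submodule.span R (s : Set (Hecke q n)),
      y * x ∈ Submodule.span R (s : Set (Hecke q n)) := by
    induction x using hecke_induction with
    | scalar r =>
      intro y hy
      rw [← Algebra.commutes, ← Algebra.smul_def]
      exact Submodule.smul_mem _ _ hy
    | gen i =>
      intro y hy
      rw [← T_coe]
      have := Finset.mem_Ico.1 i.2
      exact hmul i (by omega) this.2 y hy
    | mul x z hx hz =>
      intro y hy
      rw [← mul_assoc]
      exact hz _ (hx y hy)
    | add x z hx hz =>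
      intro y hy
      rw [mul_add]
      exact Submodule.add_mem _ (hx y hy) (hz y hy)
  simpa using key 1 h1

/-- A surjection from a free module of rank at most n! onto one of rank n! is injective over any
commutative ring (Orzech), so the spanning set satisfies no relation. -/
theorem permEval_injective (q : R) (n : ℕ) : Function.Injective (permEval q n) := by
  obtain ⟨s, hs, hspan⟩ := exists_finset_span_eq_top q n
  let g : (s →₀ R) →ₗ[R] Hecke q n := Finsupp.linearCombination R Subtype.val
  have hg : Function.Surjective g := by
    rw [← LinearMap.range_eq_top, Finsupp.range_linearCombination]
    simpa using hspan
  obtain ⟨e⟩ : Nonempty (s ↪ Equiv.Perm (Fin n)) :=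
    Function.Embedding.nonempty_of_card_le (by simpa [Fintype.card_perm] using hs)
  have hinj : Function.Injective ((permEval q n).comp g) :=
    OrzechProperty.injective_of_surjective_of_injective
      (Finsupp.lmapDomain R R e) _ (Finsupp.mapDomain_injective e.injective)
      ((permEval_surjective q n).comp hg)
  intro x y hxy
  obtain ⟨x, rfl⟩ := hg x
  obtain ⟨y, rfl⟩ := hg y
  rw [hinj hxy]

/-- Faithfulness of `permEval` makes the arbitrary choice of reduced word in `Tw` harmless. -/
theorem Tw_mul_left (q : R) {n : ℕ} (i : Gen n) {w : Equiv.Perm (Fin n)}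
    (hw : w⁻¹ (letter i) < w⁻¹ (nextLetter i)) : Tw q (simpleSwap i * w) = gen q n i * Tw q w :=
  permEval_injective q n (by rw [permEval_Tw, permEval_gen_mul q i (permEval_Tw q w) hw])

theorem Tw_one (q : R) (n : ℕ) : Tw q (1 : Equiv.Perm (Fin n)) = 1 :=
  permEval_injective q n (by rw [permEval_Tw, permEval_one])

theorem eq_of_smul_eq_smul [IsDomain R] {q : R} {n : ℕ} {c : R} (hc : c ≠ 0) {x y : Hecke q n}
    (h : c • x = c • y) : x = y := by
  apply permEval_injective q n
  have := congrArg (permEval q n) h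
  rw [map_smul, map_smul] at this
  ext w
  have := DFunLike.congr_fun this w
  exact mul_left_cancel₀ hc this

end Spanning

/-! ### The recursive Jucys–Murphy elements agree with sums over transpositions. -/

section JucysMurphy

variable {R : Type*} [CommRing R]

open Equiv (Perm swap)

theorem antiHom_gen (q : R) {n : ℕ} (i : Gen n) :
    antiHom q n (gen q n i) = MulOpposite.op (gen q n i) := by
  simp [antiHom, gen]

theorem antiHom_T (q : R) (n i : ℕ) :
    antiHom q n (T q n i) = MulOpposite.op (T q n i) := by
  by_cases hi : i ∈ Finset.Ico 1 n
  · rw [T_of_mem q hi, antiHom_gen]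
  · rw [T_of_not_mem q hi, map_zero, MulOpposite.op_zero]

theorem heckeStar_gen (q : R) {n : ℕ} (i : Gen n) : heckeStar (gen q n i) = gen q n i := by
  rw [heckeStar, antiHom_gen, MulOpposite.unop_op]

theorem heckeStar_mul {q : R} {n : ℕ} (x y : Hecke q n) :
    heckeStar (x * y) = heckeStar y * heckeStar x := by
  simp [heckeStar]

theorem heckeStar_list_prod (q : R) {n : ℕ} (l : List (Gen n)) :
    heckeStar (l.map (gen q n)).prod = (l.reverse.map (gen q n)).prod := by
  induction l with
  | nil => simp [heckeStar]
  | cons i l ih => simp [heckeStar_mul, ih, heckeStar_gen]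

theorem prod_reverse_simpleSwap {n : ℕ} (l : List (Gen n)) :
    (l.reverse.map simpleSwap).prod = (l.map simpleSwap).prod⁻¹ := by
  induction l with
  | nil => simp
  | cons i l ih =>
    have : (simpleSwap i)⁻¹ = simpleSwap i := Equiv.swap_inv _ _
    simp only [List.reverse_cons, List.map_append, List.prod_append, ih, List.map_cons,
      List.map_nil, List.prod_cons, List.prod_nil, mul_one, mul_inv_rev, this]

theorem IsReducedExpr.reverse {n : ℕ} {w : Perm (Fin n)} {l : List (Gen n)}
    (h : IsReducedExpr w l) : IsReducedExpr w⁻¹ l.reverse := by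
  refine ⟨by rw [prod_reverse_simpleSwap, h.1], fun l' hl' => ?_⟩
  have := h.2 l'.reverse (by rw [prod_reverse_simpleSwap, hl', inv_inv])
  simpa using this

theorem heckeStar_Tw (q : R) {n : ℕ} (w : Perm (Fin n)) : heckeStar (Tw q w) = Tw q w⁻¹ := by
  apply permEval_injective q n
  rw [permEval_Tw, Tw, heckeStar_list_prod]
  exact permEval_of_isReducedExpr q _ (exists_isReducedExpr w).choose_spec.reverse

theorem Tw_mul_right (q : R) {n : ℕ} (i : Gen n) {w : Perm (Fin n)}
    (hw : w (letter i) < w (nextLetter i)) : Tw q (w * simpleSwap i) = Tw q w * gen q n i := by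
  have hs : (simpleSwap i)⁻¹ = simpleSwap i := Equiv.swap_inv _ _
  have := congrArg heckeStar (Tw_mul_left q i (w := w⁻¹) (by simpa using hw))
  rwa [heckeStar_mul, heckeStar_Tw, heckeStar_Tw, heckeStar_gen, mul_inv_rev, inv_inv, hs] at this

theorem Tw_simpleSwap (q : R) {n : ℕ} (i : Gen n) : Tw q (simpleSwap i) = gen q n i := by
  have := Tw_mul_left q i (w := 1) (by simpa using letter_lt_nextLetter i)
  rwa [mul_one, Tw_one, mul_one] at this

theorem Tw_swap_nextLetter (q : R) {n : ℕ} (g : Gen n) {i : Fin n} (hi : i < letter g) :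
    Tw q (swap i (nextLetter g)) = gen q n g * (Tw q (swap i (letter g)) * gen q n g) := by
  have hg := letter_lt_nextLetter g
  have e1 := Equiv.swap_apply_of_ne_of_ne (hi.trans hg).ne' hg.ne'
  have e2 := Equiv.swap_apply_of_ne_of_ne hi.ne (hi.trans hg).ne
  rw [← Tw_mul_right q g, ← Tw_mul_left q g]
  · congr 1
    rw [← mul_assoc, Equiv.mul_swap_eq_swap_mul, mul_assoc, simpleSwap_mul_self, mul_one,
      simpleSwap, e2, Equiv.swap_apply_left]
  · simp only [simpleSwap, mul_inv_rev, Equiv.swap_inv, Perm.mul_apply, Equiv.swap_apply_right,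
      e1, e2, hi]
  · rw [Equiv.swap_apply_right, e1]
    exact hi.trans hg

theorem scaledJM_T (q : R) {n : ℕ} (m : ℕ) (hm : m < n) :
    scaledJM q (T q n) (m + 1) =
      -- Elements of `Fin n` count from 0, hence the exponent `i.1 + 1`.
      ∑ i ∈ Finset.Iio (⟨m, hm⟩ : Fin n), q ^ (i.1 + 1) • Tw q (swap i ⟨m, hm⟩) := by
  induction m with
  | zero =>
    have : Finset.Iio (⟨0, hm⟩ : Fin n) = ∅ := by
      ext x
      simp [Fin.lt_def]
    rw [this, Finset.sum_empty]
    simp [scaledJM, (isHeckeSeq_T q n).zero]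
  | succ m ih =>
    have hg : m + 1 ∈ Finset.Ico 1 n := Finset.mem_Ico.2 ⟨by omega, hm⟩
    have e : Finset.Iio (⟨m + 1, hm⟩ : Fin n) =
        insert ⟨m, by omega⟩ (Finset.Iio (⟨m, by omega⟩ : Fin n)) := by
      ext x
      simp only [Finset.mem_Iio, Finset.mem_insert, Fin.lt_def, Fin.ext_iff]
      omega
    rw [scaledJM, ih (by omega), e, Finset.sum_insert (by simp), T_of_mem q hg]
    congr 1
    · rw [← Tw_simpleSwap]
      rfl
    · rw [Finset.sum_mul, Finset.mul_sum]
      refine Finset.sum_congr rfl fun i hi => ?_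
      rw [smul_mul_assoc, mul_smul_comm]
      exact congrArg _ (Tw_swap_nextLetter q ⟨m + 1, hg⟩ (Finset.mem_Iio.1 hi)).symm

theorem pow_smul_J {𝕜 : Type*} [Field 𝕜] {q : 𝕜} (hq : q ≠ 0) (n : ℕ) :
    q ^ n • J q n = scaledJM q (T q n) n := by
  cases n with
  | zero => simp [J, scaledJM]
  | succ n =>
    rw [scaledJM_T q n (Nat.lt_succ_self n), J, Finset.smul_sum]
    refine Finset.sum_bij (fun i _ => letter i) ?_ ?_ ?_ ?_
    · intro i _
      have := Finset.mem_Ico.1 i.2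
      simp only [letter, Finset.mem_Iio, Fin.lt_def]
      omega
    · intro i _ j _ hij
      have := Finset.mem_Ico.1 i.2
      have := Finset.mem_Ico.1 j.2
      simp only [letter, Fin.ext_iff] at hij
      exact Subtype.ext (by omega)
    · intro i hi
      have := Fin.lt_def.1 (Finset.mem_Iio.1 hi)
      exact ⟨⟨i.1 + 1, Finset.mem_Ico.2 ⟨by omega, by simpa using this⟩⟩, Finset.mem_univ _, rfl⟩
    · intro i _
      have := Finset.mem_Ico.1 i.2
      have e : (letter i).1 + 1 = i.1 := by simp only [letter]; omega
      rw [smul_smul, e, ← zpow_natCast, ← zpow_add₀ hq, add_sub_cancel, zpow_natCast]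
      rfl

end JucysMurphy

/-! ### Compatibility of the recursions with ring homomorphisms. -/

section Transport

variable {A A' : Type*} [Ring A] [Ring A']

/-- Agreement is required only below n, since `T q m` vanishes from index m on while `T q n` need
not. -/
theorem map_descSum (f : A →+* A') {t : ℕ → A} {t' : ℕ → A'} {n : ℕ}
    (h : ∀ i < n, f (t i) = t' i) : f (descSum t 0 n) = descSum t' 0 n := by
  induction n with
  | zero => exact map_zero f
  | succ n ih =>
    rw [descSum, descSum, map_add, map_one, map_mul, ih fun i hi => h i (by omega), zero_add,
      h n (by omega)]

theorem map_ascSum (f : A →+* A') {t : ℕ → A} {t' : ℕ → A'} {n : ℕ}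
    (h : ∀ i < n, f (t i) = t' i) : f (ascSum t 0 n) = ascSum t' 0 n := by
  induction n with
  | zero => exact map_zero f
  | succ n ih =>
    rw [ascSum, ascSum, map_add, map_one, map_mul, ih fun i hi => h i (by omega), zero_add,
      h n (by omega)]

theorem map_shuffleSq (f : A →+* A') {t : ℕ → A} {t' : ℕ → A'} {n : ℕ} (k : ℕ)
    (h : ∀ i < n, f (t i) = t' i) : f (shuffleSq t n k) = shuffleSq t' n k := by
  induction k generalizing n with
  | zero => rw [shuffleSq_zero, shuffleSq_zero, map_one]
  | succ k ih =>
    rw [shuffleSq_succ, shuffleSq_succ, map_mul, map_mul, map_descSum f h, map_ascSum f h,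
      ih fun i hi => h i (by omega)]

theorem sum_list_prod_eq_descSum (t : ℕ → A) (n : ℕ) :
    ∑ i ∈ Finset.Icc 1 n, ((List.range' i (n - i)).reverse.map t).prod = descSum t 0 n := by
  induction n with
  | zero => simp [descSum]
  | succ n ih =>
    rw [Finset.sum_Icc_succ_top (by omega), descSum, ← ih, Finset.mul_sum, add_comm]
    congr 1
    · simp
    · refine Finset.sum_congr rfl fun i hi => ?_
      have := Finset.mem_Icc.1 hi
      rw [show n + 1 - i = n - i + 1 by omega, List.range'_concat]
      simp [show i + (n - i) = n by omega]

end Transport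

/-! ### The identity over ℤ[X], and specialisation to the field. -/

section Main

variable {R : Type*} [CommRing R]

theorem incl_gen (q : R) {m n : ℕ} (h : m ≤ n) (i : Gen m) :
    incl q h (gen q m i) = gen q n ⟨i.1, Finset.Ico_subset_Ico_right h i.2⟩ := by
  simp [incl, gen]

theorem incl_T (q : R) {m n : ℕ} (h : m ≤ n) {i : ℕ} (hi : i < m) :
    incl q h (T q m i) = T q n i := by
  by_cases h0 : 1 ≤ i
  · rw [T_of_mem q (Finset.mem_Ico.2 ⟨h0, hi⟩), incl_gen,
      T_of_mem q (Finset.mem_Ico.2 ⟨h0, by omega⟩)]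
  · rw [T_of_not_mem q (by simp; omega), T_of_not_mem q (by simp; omega), map_zero]

theorem B_eq (q : R) (n : ℕ) : B q n = descSum (T q n) 0 n := sum_list_prod_eq_descSum _ n

theorem incl_B (q : R) {m n : ℕ} (h : m ≤ n) : incl q h (B q m) = descSum (T q n) 0 m := by
  rw [B_eq]
  exact map_descSum (incl q h : Hecke q m →+* Hecke q n) fun i hi => incl_T q h hi

theorem incl_shuffleSq (q : R) {m n : ℕ} (h : m ≤ n) (k : ℕ) :
    incl q h (shuffleSq (T q m) m k) = shuffleSq (T q n) m k :=
  map_shuffleSq (incl q h : Hecke q m →+* Hecke q n) k fun _ hi => incl_T q h hi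

theorem heckeStar_Bk_mul_Bk (q : R) (n k : ℕ) :
    heckeStar (Bk q n k) * Bk q n k = shuffleSq (T q n) n k := by
  -- The index m varies while the ambient algebra H_n stays fixed, so that the induction can pass to
  -- m - 1.
  have key : ∀ m, (antiHom q n ((List.range k).reverse.map fun j =>
        descSum (T q n) 0 (m - j)).prod).unop *
      ((List.range k).reverse.map fun j => descSum (T q n) 0 (m - j)).prod =
      shuffleSq (T q n) m k := by
    induction k with
    | zero => intro m; simp [shuffleSq_zero]
    | succ k ih =>
      intro m
      have e : (((List.range (k + 1)).reverse.map fun j => descSum (T q n) 0 (m - j)).prod) =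
          ((List.range k).reverse.map fun j => descSum (T q n) 0 (m - 1 - j)).prod *
            descSum (T q n) 0 m := by
        rw [List.range_succ_eq_map]
        simp [← List.map_reverse, Function.comp_def, Nat.sub_sub, add_comm]
      rw [e, shuffleSq_succ, ← ih, map_mul, MulOpposite.unop_mul,
        IsHeckeSeq.op_ascSum (antiHom_T q n), MulOpposite.unop_op]
      simp only [mul_assoc]
  have := key n
  simp only [heckeStar, Bk, incl_B]
  exact this

open Polynomial in
theorem qFactorial_X_ne_zero (k : ℕ) : qFactorial (X : ℤ[X]) k ≠ 0 := by
  refine Finset.prod_ne_zero_iff.2 fun i hi h => ?_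
  -- At X = 1 the q-integer [i] becomes i, which is positive.
  have := congrArg (Polynomial.eval 1) h
  simp [qInt, Polynomial.eval_finsetSum] at this
  have := Finset.mem_Icc.1 hi
  omega

open Polynomial in
theorem qFactorial_smul_genericR (n k : ℕ) :
    qFactorial (X : ℤ[X]) k • genericR n k = shuffleSq (T (X : ℤ[X]) n) n k := by
  have h : ∃ r : Hecke (X : ℤ[X]) n,
      qFactorial (X : ℤ[X]) k • r = heckeStar (Bk X n k) * Bk X n k := by
    rw [heckeStar_Bk_mul_Bk]
    exact (isHeckeSeq_T _ n).exists_qFactorial_smul_eq (antiHom_T _ n) k le_rfl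
  rw [genericR, dif_pos h, h.choose_spec, heckeStar_Bk_mul_Bk]

open Polynomial in
-- The factor X^(k+1) clears the negative powers of X in X^(m+1) J_n, leaving X times the polynomial
-- element `scaledJM`. The common factor [k+1]! is then cancelled by torsion-freeness.
theorem pow_smul_B_mul_genericR (m k : ℕ) :
    (X : ℤ[X]) ^ (k + 1) • (descSum (T (X : ℤ[X]) (m + k + 1)) 0 (m + k + 1) *
        genericR (m + k + 1) (k + 1)) =
      ((X : ℤ[X]) ^ (2 * (k + 1)) •
          incl (X : ℤ[X]) (Nat.le_succ (m + k)) (genericR (m + k) (k + 1)) +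
        (((X : ℤ[X]) ^ (k + 1) * qInt (X : ℤ[X]) (m + 1)) • (1 : Hecke (X : ℤ[X]) (m + k + 1)) +
            (X : ℤ[X]) • scaledJM (X : ℤ[X]) (T (X : ℤ[X]) (m + k + 1)) (m + k + 1)) *
          incl (X : ℤ[X]) (Nat.le_succ (m + k)) (genericR (m + k) k)) *
        descSum (T (X : ℤ[X]) (m + k + 1)) 0 (m + k + 1) := by
  apply eq_of_smul_eq_smul (qFactorial_X_ne_zero (k + 1))
  have h := (isHeckeSeq_T (X : ℤ[X]) (m + k + 1)).pow_smul_descSum_mul_shuffleSq m (k + 1) le_rfl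
  simp only [← add_assoc, Nat.add_sub_cancel] at h
  rw [← incl_shuffleSq (X : ℤ[X]) (Nat.le_succ (m + k)) (k + 1),
    ← incl_shuffleSq (X : ℤ[X]) (Nat.le_succ (m + k)) k, ← qFactorial_smul_genericR,
    ← qFactorial_smul_genericR, ← qFactorial_smul_genericR, map_smul, map_smul] at h
  rw [smul_comm, ← mul_smul_comm, h, ← smul_mul_assoc (qFactorial (X : ℤ[X]) (k + 1))]
  congr 1
  rw [mul_smul_comm, qFactorial_succ]
  module

section ChangeScalars

variable {S : Type*} [CommRing S] (f : R →+* S) {q : R} {q' : S} (hf : f q = q')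

theorem changeScalars_gen {n : ℕ} (i : Gen n) :
    changeScalars f hf n (gen q n i) = gen q' n i := by
  let _ : Algebra R (Hecke q' n) := Algebra.compHom (Hecke q' n) f
  simp [changeScalars, gen]

theorem changeScalars_algebraMap (n : ℕ) (r : R) :
    changeScalars f hf n (algebraMap R _ r) = algebraMap S _ (f r) := by
  let _ : Algebra R (Hecke q' n) := Algebra.compHom (Hecke q' n) f
  exact AlgHom.commutes _ r

theorem changeScalars_smul {n : ℕ} (r : R) (x : Hecke q n) :
    changeScalars f hf n (r • x) = f r • changeScalars f hf n x := by
  rw [Algebra.smul_def, map_mul, changeScalars_algebraMap, ← Algebra.smul_def]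

theorem changeScalars_T (n i : ℕ) : changeScalars f hf n (T q n i) = T q' n i := by
  by_cases hi : i ∈ Finset.Ico 1 n
  · rw [T_of_mem q hi, T_of_mem q' hi, changeScalars_gen]
  · rw [T_of_not_mem q hi, T_of_not_mem q' hi, map_zero]

theorem changeScalars_scaledJM (n m : ℕ) :
    changeScalars f hf n (scaledJM q (T q n) m) = scaledJM q' (T q' n) m := by
  induction m with
  | zero => exact map_zero _
  | succ m ih =>
    rw [scaledJM, scaledJM, map_add, map_mul, map_mul, changeScalars_smul, ih, changeScalars_T,
      map_pow, hf]

theorem changeScalars_incl {m n : ℕ} (h : m ≤ n) (x : Hecke q m) :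
    changeScalars f hf n (incl q h x) = incl q' h (changeScalars f hf m x) := by
  induction x using hecke_induction with
  | scalar r =>
    rw [AlgHom.commutes, changeScalars_algebraMap, changeScalars_algebraMap, AlgHom.commutes]
  | gen i => rw [incl_gen, changeScalars_gen, changeScalars_gen, incl_gen]
  | mul x y hx hy => rw [map_mul, map_mul, hx, hy, map_mul, map_mul]
  | add x y hx hy => rw [map_add, map_add, hx, hy, map_add, map_add]

theorem map_qInt (hf : f q = q') (k : ℕ) : f (qInt q k) = qInt q' k := by
  simp [qInt, hf]

end ChangeScalars

theorem B_mul_R {𝕜 : Type*} [Field 𝕜] {q : 𝕜} (hq : q ≠ 0) (m k : ℕ) :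
    B q (m + k + 1) * HeckeShuffle.R q (m + k + 1) (k + 1) =
      (q ^ (k + 1) • incl q (Nat.le_succ (m + k)) (HeckeShuffle.R q (m + k) (k + 1)) +
        (algebraMap 𝕜 (Hecke q (m + k + 1)) (qInt q (m + 1)) + q ^ (m + 1) • J q (m + k + 1)) *
          incl q (Nat.le_succ (m + k)) (HeckeShuffle.R q (m + k) k)) * B q (m + k + 1) := by
  have hf : Polynomial.eval₂RingHom (Int.castRingHom 𝕜) q Polynomial.X = q := by simp
  have h := congrArg (changeScalars (Polynomial.eval₂RingHom (Int.castRingHom 𝕜) q) hf _)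
    (pow_smul_B_mul_genericR m k)
  have hB : changeScalars (Polynomial.eval₂RingHom (Int.castRingHom 𝕜) q) hf (m + k + 1)
      (descSum (T Polynomial.X (m + k + 1)) 0 (m + k + 1)) = B q (m + k + 1) := by
    rw [B_eq]
    exact map_descSum _ fun i _ => changeScalars_T _ hf _ i
  simp only [map_mul, map_add, map_one, changeScalars_smul, changeScalars_incl, hB, map_pow,
    map_qInt _ hf, changeScalars_scaledJM, hf, ← pow_smul_J hq] at h
  have hp : q ^ (k + 1) ≠ 0 := pow_ne_zero _ hq
  -- Here q ≠ 0 removes the auxiliary power q^(k+1) brought along from ℤ[X].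
  apply smul_right_injective _ hp
  refine h.trans ?_
  simp only [Algebra.algebraMap_eq_smul_one]
  rw [← smul_mul_assoc, smul_add, smul_smul, ← smul_mul_assoc, smul_add, smul_smul, smul_smul,
    smul_smul, ← pow_add, ← pow_add, ← pow_succ', two_mul,
    show k + 1 + (m + 1) = m + k + 1 + 1 by omega]
  rfl

end Main

end HeckeShuffle

theorem mainTheorem2 {𝕜 : Type*} [Field 𝕜] (q : 𝕜) (hq : q ≠ 0) (n k : ℕ)
    (hk : 1 ≤ k) (hkn : k ≤ n) :
    HeckeShuffle.B q n * HeckeShuffle.R q n k =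
      (q ^ k • HeckeShuffle.incl q (Nat.sub_le n 1) (HeckeShuffle.R q (n - 1) k) +
        (algebraMap 𝕜 (HeckeShuffle.Hecke q n) (HeckeShuffle.qInt q (n + 1 - k)) +
            q ^ (n + 1 - k) • HeckeShuffle.J q n) *
          HeckeShuffle.incl q (Nat.sub_le n 1) (HeckeShuffle.R q (n - 1) (k - 1))) *
        HeckeShuffle.B q n := by
  obtain ⟨k, rfl⟩ : ∃ j, k = j + 1 := ⟨k - 1, by omega⟩
  obtain ⟨m, rfl⟩ : ∃ m, n = m + k + 1 := ⟨n - k - 1, by omega⟩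
  rw [show m + k + 1 + 1 - (k + 1) = m + 1 by omega]
  exact HeckeShuffle.B_mul_R hq m k
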